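/- Let $R$ be a commutative ring with identity. An ideal $I$ of $R$ is called *semi-regular* if it contains a finitely generated ideal $I_0$ with $(0:_R I_0)=\{r\in R: rI_0=0\}=0$. An $R$-module $M$ is *semi-regular flat* (resp. *semi-regular coflat*) if $\mathrm{Tor}_1^R(R/I,M)=0$ (resp. $\mathrm{Ext}^1_R(R/I,M)=0$) for every finitely generated semi-regular ideal $I$ of $R$, and an $R$-module $N$ is *semi-regular cotorsion* if $\mathrm{Ext}^1_R(M,N)=0$ for every semi-regular flat $R$-module $M$. An $R$-module is *super finitely presented* if it has a resolution $\cdots\to P_1\to P_0\to M\to 0$ by finitely generated projective $R$-modules, and $$\mathrm{fPD}(R)=\sup\{\mathrm{pd}_R M : M \text{ is super finitely presented and } \mathrm{pd}_R M<\infty\}\in\mathbb{N}\cup\{\infty\},$$ where the zero module does not contribute (so $\mathrm{fPD}(0)=0$). The following statements are equivalent: 1. $R$ is a DQ ring, i.e. the only finitely generated semi-regular ideal of $R$ is $R$ itself; 2. $\mathrm{fPD}(R)=0$; 3. every $R$-module is semi-regular flat; 4. every $R$-module is semi-regular coflat; 5. every semi-regular cotorsion $R$-module is injective; 6. $I\cap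 J=IJ$ for every finitely generated semi-regular ideal $I$ and every finitely generated ideal $J$ of $R$; 7. $R/I$ is a flat $R$-module for every finitely generated semi-regular ideal $I$ of $R$; 8. for every finitely generated semi-regular ideal $I$ of $R$ and every $a\in I$ there is $c\in I$ with $(1-c)a=0$. -/

import Mathlib

open CategoryTheory

universe u

noncomputable section

namespace SemiRegular

/-- An ideal `I` is dense if `(0 :_R I) = {r | r I = 0}` is zero. -/
def IsDense {R : Type u} [CommRing R] (I : Ideal R) : Prop :=
  Submodule.annihilator I = ⊥

/-- An ideal is semi-regular if it contains a finitely generated dense ideal. -/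
def IsSemiRegular {R : Type u} [CommRing R] (I : Ideal R) : Prop :=
  ∃ I₀ : Ideal R, I₀ ≤ I ∧ I₀.FG ∧ IsDense I₀

/-- `R` is a DQ ring if its only finitely generated semi-regular ideal is `R` itself. -/
def IsDQRing (R : Type u) [CommRing R] : Prop :=
  ∀ I : Ideal R, I.FG → IsSemiRegular I → I = ⊤

/-- `M` is super finitely presented: it has a resolution by finitely generated projectives. -/
def IsSuperFinitelyPresented {R : Type u} [CommRing R] (M : ModuleCat.{u} R) : Prop :=
  ∃ P : ProjectiveResolution M, ∀ n : ℕ, Module.Finite R (P.complex.X n)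

/-- The small finitistic dimension, the supremum in `ℕ∞` of the finite projective dimensions of
super finitely presented modules. Zero modules, whose `projectiveDimension` in Mathlib is `⊥`, do
not contribute, so the zero ring has dimension `0`. -/
def smallFinitisticDim (R : Type u) [CommRing R] : ℕ∞ :=
  sSup {d : ℕ∞ | d ≠ ⊤ ∧ ∃ M : ModuleCat.{u} R,
    IsSuperFinitelyPresented M ∧ projectiveDimension M = (d : WithBot ℕ∞)}

/-- `M` is semi-regular flat: `Tor₁(R/I, M) = 0` for all finitely generated semi-regular `I`. -/
def IsSemiRegularFlat (R : Type u) [CommRing R] (M : Type u) [AddCommGroup M] [Module R M] :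
    Prop :=
  ∀ I : Ideal R, I.FG → IsSemiRegular I →
    Limits.IsZero (((Tor (ModuleCat.{u} R) 1).obj (ModuleCat.of R (R ⧸ I))).obj
      (ModuleCat.of R M))

/-- `M` is semi-regular coflat: `Ext¹(R/I, M) = 0` for all finitely generated semi-regular `I`. -/
def IsSemiRegularCoflat (R : Type u) [CommRing R] (M : Type u) [AddCommGroup M] [Module R M] :
    Prop :=
  ∀ I : Ideal R, I.FG → IsSemiRegular I →
    Subsingleton (Abelian.Ext (ModuleCat.of R (R ⧸ I)) (ModuleCat.of R M) 1)

/-- `N` is semi-regular cotorsion: `Ext¹(M, N) = 0` for all semi-regular flat `M`. -/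
def IsSemiRegularCotorsion (R : Type u) [CommRing R] (N : Type u) [AddCommGroup N]
    [Module R N] : Prop :=
  ∀ (M : Type u) [AddCommGroup M] [Module R M], IsSemiRegularFlat R M →
    Subsingleton (Abelian.Ext (ModuleCat.of R M) (ModuleCat.of R N) 1)

end SemiRegular

end

-- Everything except the finitistic dimension passes through flatness of `R ⧸ I` for finitely
-- generated semi-regular `I`. Flatness gives each `a ∈ I` a `c ∈ I` with `a = c * a`, so `I` is
-- idempotent. A finitely generated idempotent ideal is generated by an idempotent `e`, and `1 - e`
-- kills the dense ideal inside `I`, so `e = 1`. Statements 3 and 5 reach flatness through the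
-- character module of `R ⧸ I`: vanishing of Tor against `R ⧸ I` makes it semi-regular cotorsion,
-- and it is injective exactly when `R ⧸ I` is flat. Statement 4 makes `R ⧸ I` projective. For the
-- finitistic dimension, an element of a finite projective module with zero annihilator is
-- unimodular over a DQ ring, since its coordinates generate a dense ideal. Hence injections between
-- finite projectives split, and finite resolutions collapse from the left. Conversely, generators
-- of a dense ideal embed `R` in `R^n` with cokernel of projective dimension at most one; if the
-- cokernel is projective, a retraction writes 1 in these generators.

universe v w

/-! ### Split injections over a DQ ring -/

/-- Over a DQ ring, an element of a finite projective module with zero annihilator is unimodular. -/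
theorem SemiRegular.IsDQRing.exists_dual_eq_one {R : Type u} [CommRing R]
    (hR : SemiRegular.IsDQRing R) {P : Type v} [AddCommGroup P] [Module R P]
    [Module.Finite R P] [Module.Projective R P] (p : P)
    (hp : ∀ r : R, r • p = 0 → r = 0) : ∃ f : P →ₗ[R] R, f p = 1 := by
  obtain ⟨n, π, hπ⟩ := Module.Finite.exists_fin' R P
  obtain ⟨s, hs⟩ := Module.projective_lifting_property π LinearMap.id hπ
  have hs' : ∀ q, π (s q) = q := fun q => LinearMap.congr_fun hs q
  have hfg : (Ideal.span (Set.range (s p))).FG :=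
    Submodule.fg_span (Set.finite_range _)
  have hd : SemiRegular.IsDense (Ideal.span (Set.range (s p))) := by
    rw [SemiRegular.IsDense, eq_bot_iff]
    intro r hr
    apply hp
    have : r • s p = 0 := by
      ext i
      exact (Submodule.mem_annihilator.1 hr) _ (Ideal.subset_span ⟨i, rfl⟩)
    rw [← hs' p, ← map_smul, this, map_zero]
  have h1 : (1 : R) ∈ Ideal.span (Set.range (s p)) := by
    rw [hR _ hfg ⟨_, le_rfl, hfg, hd⟩]; trivial
  obtain ⟨c, hc⟩ := (Submodule.mem_span_range_iff_exists_fun R).1 h1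
  exact ⟨(∑ i, c i • LinearMap.proj i) ∘ₗ s, by simpa using hc⟩

/-- Over a DQ ring, every injective linear map from a finite free module to a finite projective
module is split. -/
theorem SemiRegular.IsDQRing.exists_leftInverse_of_injective_pi {R : Type u} [CommRing R]
    (hR : SemiRegular.IsDQRing R) {P : Type v} [AddCommGroup P] [Module R P]
    [Module.Finite R P] [Module.Projective R P] (m : ℕ) (φ : (Fin m → R) →ₗ[R] P)
    (hφ : Function.Injective φ) : ∃ ψ : P →ₗ[R] (Fin m → R), ψ ∘ₗ φ = LinearMap.id := by
  induction m with
  | zero => exact ⟨0, LinearMap.ext fun x => Subsingleton.elim _ _⟩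
  | succ m ih =>
    let e : Fin (m + 1) → R := Pi.single 0 1
    let j : (Fin m → R) →ₗ[R] (Fin (m + 1) → R) :=
      LinearMap.vecCons 0 LinearMap.id
    have hj0 : ∀ x, j x 0 = 0 := fun x => rfl
    have hjs : ∀ x i, j x (Fin.succ i) = x i := fun x i => rfl
    have hdecomp : ∀ x : Fin (m + 1) → R, x = x 0 • e + j (Fin.tail x) := by
      intro x
      ext i
      refine Fin.cases ?_ (fun i => ?_) i
      · simp [e, hj0]
      · simp [e, hjs, Fin.tail]
    obtain ⟨f, hf⟩ := hR.exists_dual_eq_one (φ e) fun r hr => by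
      have h : r • e = 0 := hφ (by simpa using hr)
      simpa [e] using congrFun h 0
    -- The projection onto `ker f` along `φ e`; the remaining basis vectors stay independent after
    -- it.
    let π : P →ₗ[R] P := LinearMap.id - f.smulRight (φ e)
    have hπ : ∀ x, π x = x - f x • φ e := fun x => rfl
    obtain ⟨ψ, hψ⟩ := ih (π ∘ₗ φ ∘ₗ j) <| by
      rw [injective_iff_map_eq_zero]
      intro x hx
      have h : j x = f (φ (j x)) • e := hφ (by
        rw [map_smul]
        exact sub_eq_zero.1 hx)
      have h0 : f (φ (j x)) = 0 := by simpa [e, hj0] using (congrFun h 0).symm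
      ext i
      rw [← hjs x i, h, h0]
      simp
    have hψ' : ∀ x, ψ (π (φ (j x))) = x := fun x => LinearMap.congr_fun hψ x
    have hπe : π (φ e) = 0 := by simp [hπ, hf]
    -- `f` need not vanish on the image of `φ ∘ₗ j`, so the tail's contribution is subtracted before
    -- reading off the zeroth coordinate.
    refine ⟨LinearMap.vecCons (f ∘ₗ (LinearMap.id - φ ∘ₗ j ∘ₗ ψ ∘ₗ π)) (ψ ∘ₗ π),
      LinearMap.ext fun x => ?_⟩
    have hy : ψ (π (φ x)) = Fin.tail x := by
      conv_lhs => rw [hdecomp x]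
      simp [hπe, hψ']
    have hx0 : f (φ x - φ (j (Fin.tail x))) = x 0 := by
      rw [← map_sub, sub_eq_of_eq_add (hdecomp x)]
      simp [hf]
    ext i
    refine Fin.cases ?_ (fun i => ?_) i
    · simpa [hy] using hx0
    · simp [hy, Fin.tail]

/-- Over a DQ ring, every injective linear map between finite projective modules is split. -/
theorem SemiRegular.IsDQRing.exists_leftInverse_of_injective {R : Type u} [CommRing R]
    (hR : SemiRegular.IsDQRing R) {Q : Type w} {P : Type v} [AddCommGroup Q] [Module R Q]
    [Module.Finite R Q] [Module.Projective R Q] [AddCommGroup P] [Module R P]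
    [Module.Finite R P] [Module.Projective R P] (φ : Q →ₗ[R] P)
    (hφ : Function.Injective φ) : ∃ ψ : P →ₗ[R] Q, ψ ∘ₗ φ = LinearMap.id := by
  obtain ⟨m, π, hπ⟩ := Module.Finite.exists_fin' R Q
  obtain ⟨s, hs⟩ := Module.projective_lifting_property π LinearMap.id hπ
  have hs' : ∀ q, π (s q) = q := fun q => LinearMap.congr_fun hs q
  -- Adding the complement `ker π` of `Q`, mapped identically, makes the source free while keeping
  -- the map injective.
  let Φ : (Fin m → R) →ₗ[R] P × (Fin m → R) := (φ ∘ₗ π).prod (LinearMap.id - s ∘ₗ π)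
  have hΦ : Function.Injective Φ := by
    rw [injective_iff_map_eq_zero]
    intro x hx
    obtain ⟨h1, h2⟩ := Prod.ext_iff.1 hx
    have h3 : π x = 0 := hφ (by simpa [Φ] using h1)
    simpa [Φ, h3] using h2
  obtain ⟨ψ, hψ⟩ := SemiRegular.IsDQRing.exists_leftInverse_of_injective_pi hR m Φ hΦ
  refine ⟨π ∘ₗ ψ ∘ₗ LinearMap.inl R P _, LinearMap.ext fun q => ?_⟩
  have h : Φ (s q) = (φ q, 0) := by simp [Φ, hs']
  have := LinearMap.congr_fun hψ (s q)
  simp only [LinearMap.comp_apply, h, LinearMap.id_apply] at this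
  simp [this, hs']

/-! ### Idempotent semi-regular ideals -/

/-- A finitely generated idempotent semi-regular ideal is the whole ring. -/
theorem SemiRegular.IsSemiRegular.eq_top_of_isIdempotentElem {R : Type u} [CommRing R] {I : Ideal R}
    (hI : I.FG) (h : SemiRegular.IsSemiRegular I) (hid : IsIdempotentElem I) : I = ⊤ := by
  obtain ⟨e, he, rfl⟩ := (Ideal.isIdempotentElem_iff_of_fg I hI).1 hid
  obtain ⟨I₀, hle, -, hd⟩ := h
  have h1 : 1 - e ∈ Submodule.annihilator I₀ := by
    rw [Submodule.mem_annihilator]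
    intro x hx
    obtain ⟨c, rfl⟩ := Submodule.mem_span_singleton.1 (hle hx)
    simp only [smul_eq_mul]
    linear_combination (-c) * he.eq
  rw [hd, Submodule.mem_bot, sub_eq_zero] at h1
  rw [← h1]
  simp

/-! ### Character modules: from Tor to Ext -/

/-- A character vanishing on the kernel of an additive map extends along that map. -/
theorem CharacterModule.exists_comp_eq_of_ker_le {A B : Type*} [AddCommGroup A] [AddCommGroup B]
    (α : A →+ B) (c : A →+ AddCircle (1 : ℚ)) (h : α.ker ≤ c.ker) :
    ∃ c' : B →+ AddCircle (1 : ℚ), ∀ a, c' (α a) = c a := by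
  obtain ⟨c', hc'⟩ := (Module.Baer.of_divisible (AddCircle (1 : ℚ))).extension_property_addMonoidHom
    (QuotientAddGroup.kerLift α) (QuotientAddGroup.kerLift_injective α)
    (QuotientAddGroup.lift α.ker c h)
  exact ⟨c', fun a => DFunLike.congr_fun hc' (a : A ⧸ α.ker)⟩

open MonoidalCategory TensorProduct in
/-- If `Tor₁(X, M) = 0` then `Ext¹(M, X⁺) = 0`, where `X⁺` is the character module of `X`. -/
theorem subsingleton_ext_characterModule_of_isZero_tor {R : Type u} [CommRing R]
    (X M : Type u) [AddCommGroup X] [Module R X] [AddCommGroup M] [Module R M]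
    (h : Limits.IsZero (((Tor (ModuleCat.{u} R) 1).obj (ModuleCat.of R X)).obj
      (ModuleCat.of R M))) :
    Subsingleton (Abelian.Ext (ModuleCat.of R M)
      (ModuleCat.of R (CharacterModule X)) 1) := by
  let P := projectiveResolution (ModuleCat.of R M)
  let F := (tensoringLeft (ModuleCat.{u} R)).obj (ModuleCat.of R X)
  have hex : ((F.mapHomologicalComplex (ComplexShape.down ℕ)).obj P.complex).ExactAt 1 := by
    rw [HomologicalComplex.exactAt_iff_isZero_homology]
    exact h.of_iso (P.isoLeftDerivedObj F 1).symm
  rw [HomologicalComplex.exactAt_iff' _ 2 1 0 (by simp) (by simp),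
    ShortComplex.moduleCat_exact_iff] at hex
  refine subsingleton_of_forall_eq 0 fun x => ?_
  obtain ⟨f, hf, rfl⟩ := P.extMk_surjective x 2 rfl
  rw [P.extMk_eq_zero_iff f 2 rfl hf 0 rfl]
  -- By adjunction the cocycle `f` is a character of `X ⊗ P₁` killing the image of `X ⊗ P₂`. Since
  -- Tor vanishes, that image is the kernel of the map to `X ⊗ P₀`, so the character extends and `f`
  -- is a coboundary.
  let c : X ⊗[R] P.complex.X 1 →+ AddCircle (1 : ℚ) :=
    (CharacterModule.uncurry f.hom).comp
      (TensorProduct.comm R X (P.complex.X 1)).toAddMonoidHom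
  have hc : ∀ x p, c (x ⊗ₜ p) = f.hom p x := fun x p => rfl
  have hcd : ∀ y, c ((P.complex.d 2 1).hom.lTensor X y) = 0 := fun y => by
    induction y with
    | zero => simp
    | tmul x p =>
      rw [LinearMap.lTensor_tmul, hc]
      have : f.hom ((P.complex.d 2 1).hom p) = 0 := ConcreteCategory.congr_hom hf p
      rw [this]
      rfl
    | add y z hy hz => rw [map_add, map_add, hy, hz, add_zero]
  obtain ⟨c', hc'⟩ := CharacterModule.exists_comp_eq_of_ker_le
    ((P.complex.d 1 0).hom.lTensor X).toAddMonoidHom c fun t ht => by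
      obtain ⟨y, hy⟩ := hex t ht
      rw [AddMonoidHom.mem_ker, ← hcd y]
      exact congrArg c hy.symm
  let g : P.complex.X 0 →ₗ[R] CharacterModule X :=
    CharacterModule.curry (c'.comp (TensorProduct.comm R (P.complex.X 0) X).toAddMonoidHom)
  refine ⟨ModuleCat.ofHom g, ?_⟩
  ext p x
  exact hc' (x ⊗ₜ p)

/-! ### Splicing projective resolutions -/

/-- A complex of projectives, exact in positive degrees, together with an augmentation that is a
cokernel of the last differential, is a projective resolution. -/
noncomputable def projectiveResolutionOfExact {C : Type u} [Category.{v} C] [Abelian C] {Z : C}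
    (K : ChainComplex C ℕ) [∀ n, Projective (K.X n)] (ε : K.X 0 ⟶ Z) (hepi : Epi ε)
    (w : K.d 1 0 ≫ ε = 0) (h₀ : (ShortComplex.mk (K.d 1 0) ε w).Exact)
    (h : ∀ n, K.ExactAt (n + 1)) : ProjectiveResolution Z where
  complex := K
  π := (ChainComplex.toSingle₀Equiv _ _).symm ⟨ε, w⟩
  quasiIso := ⟨fun n => by
    cases n with
    | zero =>
      have hε : ((ChainComplex.toSingle₀Equiv K Z).symm ⟨ε, w⟩).f 0 = ε :=
        ChainComplex.toSingle₀Equiv_symm_apply_f_zero ε w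
      rw [ChainComplex.quasiIsoAt₀_iff, ShortComplex.quasiIso_iff_of_zeros']
      · refine ⟨?_, ?_⟩
        · refine (ShortComplex.exact_iff_of_iso ?_).2 h₀
          exact ShortComplex.isoMk (Iso.refl _) (Iso.refl _) (Iso.refl _)
            ((Category.id_comp _).trans (Category.comp_id _).symm)
            ((Category.id_comp _).trans (hε.symm.trans (Category.comp_id _).symm))
        · change Epi (((ChainComplex.toSingle₀Equiv K Z).symm ⟨ε, w⟩).f 0)
          rwa [hε]
      · exact K.shape _ _ (by simp)
      all_goals rfl
    | succ n =>
      rw [quasiIsoAt_iff_exactAt']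
      · exact h n
      · exact ChainComplex.exactAt_succ_single_obj _ _⟩

/-- Splicing a projective resolution of `S.X₁` with a short exact sequence `S` whose middle term is
projective gives a projective resolution of `S.X₃`. -/
theorem exists_projectiveResolution_of_shortExact {C : Type u} [Category.{v} C] [Abelian C]
    {S : ShortComplex C} (hS : S.ShortExact) [Projective S.X₂] (Q : ProjectiveResolution S.X₁) :
    ∃ P : ProjectiveResolution S.X₃, P.complex.X 0 = S.X₂ ∧
      ∀ n, P.complex.X (n + 1) = Q.complex.X n := by
  obtain ⟨ε, w, hεepi, hε⟩ : ∃ (ε : Q.complex.X 0 ⟶ S.X₁) (w : Q.complex.d 1 0 ≫ ε = 0),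
      Epi ε ∧ (ShortComplex.mk _ _ w).Exact :=
    ⟨Q.π.f 0, Q.complex_d_comp_π_f_zero, inferInstanceAs (Epi (Q.π.f 0)), Q.exact₀⟩
  have w' : Q.complex.d 1 0 ≫ ε ≫ S.f = 0 := by rw [reassoc_of% w, Limits.zero_comp]
  let K := Q.complex.augment (ε ≫ S.f) w'
  have : ∀ n, Projective (K.X n)
    | 0 => inferInstanceAs (Projective S.X₂)
    | n + 1 => Q.projective n
  have w₀ : (ε ≫ S.f) ≫ S.g = 0 := by simp
  have h₀ : (ShortComplex.mk (ε ≫ S.f) S.g w₀).Exact := by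
    let φ : ShortComplex.mk (ε ≫ S.f) S.g w₀ ⟶ S := { τ₁ := ε, τ₂ := 𝟙 _, τ₃ := 𝟙 _ }
    have : Epi φ.τ₁ := hεepi
    have : IsIso φ.τ₂ := inferInstanceAs (IsIso (𝟙 _))
    have : Mono φ.τ₃ := inferInstanceAs (Mono (𝟙 _))
    exact (ShortComplex.exact_iff_of_epi_of_isIso_of_mono φ).2 hS.exact
  have h₁ : (ShortComplex.mk (Q.complex.d 1 0) (ε ≫ S.f) w').Exact := by
    let φ : ShortComplex.mk (Q.complex.d 1 0) ε w ⟶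
        ShortComplex.mk (Q.complex.d 1 0) (ε ≫ S.f) w' := { τ₁ := 𝟙 _, τ₂ := 𝟙 _, τ₃ := S.f }
    have : Epi φ.τ₁ := inferInstanceAs (Epi (𝟙 _))
    have : IsIso φ.τ₂ := inferInstanceAs (IsIso (𝟙 _))
    have : Mono φ.τ₃ := hS.mono_f
    exact (ShortComplex.exact_iff_of_epi_of_isIso_of_mono φ).1 hε
  refine ⟨projectiveResolutionOfExact K (Z := S.X₃) S.g hS.epi_g w₀ h₀ fun n => ?_, rfl, fun _ => rfl⟩
  rw [HomologicalComplex.exactAt_iff' _ (n + 2) (n + 1) n (by simp) (by simp)]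
  cases n with
  | zero => exact h₁
  | succ n => exact Q.exact_succ n

/-! ### The small finitistic dimension -/

/-- In an exact complex of finite projective modules over a DQ ring, every cokernel of a differential
that has finite projective dimension is projective. -/
theorem SemiRegular.IsDQRing.projective_of_hasProjectiveDimensionLE {R : Type u} [CommRing R]
    (hR : SemiRegular.IsDQRing R) (K : ChainComplex (ModuleCat.{u} R) ℕ)
    [∀ i, Module.Finite R (K.X i)] [∀ i, Projective (K.X i)]
    (hK : ∀ i, K.ExactAt (i + 1)) (n : ℕ) :
    ∀ (k : ℕ) (Z : ModuleCat.{u} R) (g : K.X k →ₗ[R] Z), Function.Surjective g →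
      LinearMap.ker g = LinearMap.range (K.d (k + 1) k).hom → HasProjectiveDimensionLE Z n →
      Module.Projective R Z := by
  induction n with
  | zero =>
    intro k Z g _ _ hpd
    rw [IsProjective.iff_projective]
    exact (projective_iff_hasProjectiveDimensionLE_zero Z).2 hpd
  | succ n ih =>
    intro k Z g hg hker hpd
    have hS := LinearMap.shortExact_shortComplexKer hg
    have hpd' : HasProjectiveDimensionLE (ModuleCat.of R (LinearMap.ker g)) n :=
      (hS.hasProjectiveDimensionLT_X₃_iff n (inferInstanceAs (Projective (K.X k)))).1 hpd
    let g' : K.X (k + 1) →ₗ[R] LinearMap.ker g :=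
      (K.d (k + 1) k).hom.codRestrict _ fun x => hker ▸ LinearMap.mem_range_self _ x
    have hg' : Function.Surjective g' := by
      rintro ⟨z, hz⟩
      obtain ⟨y, rfl⟩ := hker ▸ hz
      exact ⟨y, rfl⟩
    have hker' : LinearMap.ker g' = LinearMap.range (K.d (k + 1 + 1) (k + 1)).hom := by
      have h := hK k
      rw [HomologicalComplex.exactAt_iff' _ (k + 2) (k + 1) k (by simp) (by simp),
        ShortComplex.moduleCat_exact_iff_range_eq_ker] at h
      rw [LinearMap.ker_codRestrict]
      exact h.symm
    have hproj : Module.Projective R (LinearMap.ker g) :=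
      ih (k + 1) (ModuleCat.of R (LinearMap.ker g)) g' hg' hker' hpd'
    have hfin : Module.Finite R (LinearMap.ker g) := Module.Finite.of_surjective g' hg'
    have hXk : Module.Projective R (K.X k) := (IsProjective.iff_projective _).2 inferInstance
    have hinj := (LinearMap.ker g).injective_subtype
    -- The syzygy is finite projective, so its inclusion splits and `Z` is a summand of `K.X k`.
    obtain ⟨s, hs⟩ := ((LinearMap.exact_subtype_ker_map g).split_tfae hinj hg).out 1 0 |>.1
      (hR.exists_leftInverse_of_injective _ hinj)
    exact Module.Projective.of_split s g hs

/-- A super finitely presented module of finite projective dimension over a DQ ring is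
projective. -/
theorem SemiRegular.IsDQRing.projective_of_isSuperFinitelyPresented {R : Type u} [CommRing R]
    (hR : SemiRegular.IsDQRing R) {M : ModuleCat.{u} R}
    (hM : SemiRegular.IsSuperFinitelyPresented M) (n : ℕ) (hn : HasProjectiveDimensionLE M n) :
    Projective M := by
  obtain ⟨P, hP⟩ := hM
  rw [← IsProjective.iff_projective]
  have hex := P.exact₀
  rw [ShortComplex.moduleCat_exact_iff_range_eq_ker] at hex
  have hepi : Epi (P.π.f 0) := inferInstance
  exact hR.projective_of_hasProjectiveDimensionLE P.complex P.complex_exactAt_succ n 0 M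
    (P.π.f 0).hom ((ModuleCat.epi_iff_surjective _).1 hepi) hex.symm hn

theorem SemiRegular.IsDQRing.smallFinitisticDim_eq_zero {R : Type u} [CommRing R]
    (hR : SemiRegular.IsDQRing R) : SemiRegular.smallFinitisticDim R = 0 := by
  rw [SemiRegular.smallFinitisticDim, ← bot_eq_zero, sSup_eq_bot]
  rintro d ⟨hd, M, hM, hdim⟩
  obtain ⟨n, rfl⟩ := ENat.ne_top_iff_exists.1 hd
  have hproj := hR.projective_of_isSuperFinitelyPresented hM n
    ((projectiveDimension_le_iff M n).1 hdim.le)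
  have := (projectiveDimension_le_iff M 0).2
    ((projective_iff_hasProjectiveDimensionLE_zero M).1 hproj)
  rw [hdim] at this
  rw [bot_eq_zero]
  exact nonpos_iff_eq_zero.1 (by exact_mod_cast this)

/-- A module with a length one resolution by finite projectives is super finitely presented. -/
theorem isSuperFinitelyPresented_of_shortExact {R : Type u} [CommRing R]
    {S : ShortComplex (ModuleCat.{u} R)} (hS : S.ShortExact) [Projective S.X₁] [Projective S.X₂]
    [Module.Finite R S.X₁] [Module.Finite R S.X₂] :
    SemiRegular.IsSuperFinitelyPresented S.X₃ := by
  obtain ⟨P, h0, hs⟩ := exists_projectiveResolution_of_shortExact hS (.self S.X₁)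
  refine ⟨P, fun n => ?_⟩
  match n with
  | 0 => rw [h0]; infer_instance
  | 1 => rw [hs 0]; exact inferInstanceAs (Module.Finite R S.X₁)
  | n + 2 =>
    rw [hs (n + 1)]
    have : Subsingleton ((ProjectiveResolution.self S.X₁).complex.X (n + 1)) :=
      ModuleCat.isZero_iff_subsingleton.1 (HomologicalComplex.isZero_single_obj_X _ _ _ _ (by simp))
    infer_instance

theorem projective_of_smallFinitisticDim_eq_zero {R : Type u} [CommRing R]
    (h : SemiRegular.smallFinitisticDim R = 0) {M : ModuleCat.{u} R}
    (hM : SemiRegular.IsSuperFinitelyPresented M) {n : ℕ} (hn : HasProjectiveDimensionLE M n) :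
    Projective M := by
  rw [projective_iff_hasProjectiveDimensionLE_zero, ← projectiveDimension_le_iff]
  have hle := (projectiveDimension_le_iff M n).2 hn
  generalize hd : projectiveDimension M = d at hle
  induction d with
  -- The zero module lies outside the supremum but is projective anyway.
  | bot => exact bot_le
  | coe d =>
    have htop : d ≠ ⊤ := fun ht => by
      rw [ht] at hle
      exact ENat.natCast_ne_top n (top_le_iff.1 (WithBot.coe_le_coe.1 hle))
    have : d ≤ SemiRegular.smallFinitisticDim R := le_sSup ⟨htop, M, hM, hd⟩
    rw [h] at this
    exact_mod_cast this

/-- Density of the ideal generated by `a₁, …, aₙ` is injectivity of `r ↦ (r a₁, …, r aₙ)`; a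
retraction of this map exhibits 1 as a combination of the `aᵢ`. -/
theorem isDQRing_of_smallFinitisticDim_eq_zero {R : Type u} [CommRing R]
    (h : SemiRegular.smallFinitisticDim R = 0) : SemiRegular.IsDQRing R := by
  rintro I hI ⟨I₀, hle, hfg, hd⟩
  refine top_le_iff.1 (le_trans ?_ hle)
  obtain ⟨n, a, rfl⟩ := Submodule.fg_iff_exists_fin_generating_family.1 hfg
  let α : R →ₗ[R] (Fin n → R) := LinearMap.toSpanSingleton R _ a
  have hα : Function.Injective α := by
    rw [injective_iff_map_eq_zero]
    intro r hr
    rw [← Submodule.mem_bot R, ← hd, Submodule.mem_annihilator_span]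
    rintro ⟨_, i, rfl⟩
    exact congrFun hr i
  have hex := LinearMap.exact_map_mkQ_range α
  have hS := ModuleCat.shortComplex_shortExact
    (ModuleCat.shortComplexOfCompEqZero α _ hex.linearMap_comp_eq_zero) hex hα
    (Submodule.mkQ_surjective _)
  have hP₁ : Projective (ModuleCat.of R R) :=
    ModuleCat.projective_of_free (Module.Basis.singleton Unit R)
  have hP₂ : Projective (ModuleCat.of R (Fin n → R)) :=
    ModuleCat.projective_of_free (Pi.basisFun R (Fin n))
  have hM := @isSuperFinitelyPresented_of_shortExact R _ _ hS hP₁ hP₂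
    (inferInstanceAs (Module.Finite R R)) (inferInstanceAs (Module.Finite R (Fin n → R)))
  have hproj := projective_of_smallFinitisticDim_eq_zero h hM (n := 1)
    ((hS.hasProjectiveDimensionLT_X₃_iff 0 hP₂).2
      (projective_iff_hasProjectiveDimensionLT_one.1 hP₁))
  have hproj' : Module.Projective R ((Fin n → R) ⧸ LinearMap.range α) :=
    (IsProjective.iff_projective _).2 hproj
  obtain ⟨s, hs⟩ := Module.projective_lifting_property (LinearMap.range α).mkQ LinearMap.id
    (Submodule.mkQ_surjective _)
  have hsplit : ∃ l : (Fin n → R) →ₗ[R] R, l ∘ₗ α = LinearMap.id :=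
    ((hex.split_tfae hα (Submodule.mkQ_surjective _)).out 0 1 :).1 (Exists.intro s hs)
  obtain ⟨l, hl⟩ := hsplit
  have h1 : l a = 1 := by simpa [α] using LinearMap.congr_fun hl 1
  rw [← Ideal.eq_top_iff_one _ |>.2 ?_]
  rw [← h1, LinearMap.pi_apply_eq_sum_univ]
  exact Ideal.sum_mem _ fun i _ => Ideal.mul_mem_right _ _ (Ideal.subset_span ⟨i, rfl⟩)

/-! ### The equivalences -/

open MonoidalCategory TensorProduct in
theorem isZero_tor_of_subsingleton {R : Type u} [CommRing R] (X M : ModuleCat.{u} R)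
    [Subsingleton X] (n : ℕ) :
    Limits.IsZero (((Tor (ModuleCat.{u} R) n).obj X).obj M) := by
  refine Limits.IsZero.of_iso ?_ ((projectiveResolution M).isoLeftDerivedObj
    ((tensoringLeft (ModuleCat.{u} R)).obj X) n)
  refine (HomologicalComplex.exactAt_iff_isZero_homology _ _).1
    (ShortComplex.exact_of_isZero_X₂ _ ?_)
  refine ModuleCat.isZero_iff_subsingleton.2
    (inferInstanceAs (Subsingleton (X ⊗[R] (projectiveResolution M).complex.X n)))

theorem theorem3p1 (R : Type u) [CommRing R] :
    List.TFAE [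
      SemiRegular.IsDQRing R,
      SemiRegular.smallFinitisticDim R = 0,
      ∀ (M : Type u) [AddCommGroup M] [Module R M], SemiRegular.IsSemiRegularFlat R M,
      ∀ (M : Type u) [AddCommGroup M] [Module R M], SemiRegular.IsSemiRegularCoflat R M,
      ∀ (N : Type u) [AddCommGroup N] [Module R N],
        SemiRegular.IsSemiRegularCotorsion R N → Module.Injective R N,
      ∀ I J : Ideal R, I.FG → SemiRegular.IsSemiRegular I → J.FG → I ⊓ J = I * J,
      ∀ I : Ideal R, I.FG → SemiRegular.IsSemiRegular I → Module.Flat R (R ⧸ I),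
      ∀ I : Ideal R, I.FG → SemiRegular.IsSemiRegular I →
        ∀ a ∈ I, ∃ c ∈ I, (1 - c) * a = 0] := by
  have hflat : SemiRegular.IsDQRing R →
      ∀ (M : Type u) [AddCommGroup M] [Module R M], SemiRegular.IsSemiRegularFlat R M := by
    intro h M _ _ I hI hs
    obtain rfl := h I hI hs
    exact isZero_tor_of_subsingleton _ _ 1
  have hcot : ∀ I : Ideal R, I.FG → SemiRegular.IsSemiRegular I →
      SemiRegular.IsSemiRegularCotorsion R (CharacterModule (R ⧸ I)) :=
    fun I hI hs M _ _ hM =>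
      subsingleton_ext_characterModule_of_isZero_tor (R ⧸ I) M (hM I hI hs)
  tfae_have 1 → 2 := fun h => h.smallFinitisticDim_eq_zero
  tfae_have 2 → 1 := isDQRing_of_smallFinitisticDim_eq_zero
  tfae_have 1 → 3 := hflat
  tfae_have 1 → 4 := by
    intro h M _ _ I hI hs
    obtain rfl := h I hI hs
    have : Projective (ModuleCat.of R (R ⧸ (⊤ : Ideal R))) :=
      (ModuleCat.isZero_of_subsingleton _).projective
    exact projective_iff_subsingleton_ext_one.1 this (Y := ModuleCat.of R M)
  tfae_have 1 → 5 := by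
    intro h N _ _ hN
    -- All modules are semi-regular flat here, so cotorsion means that every `Ext¹` into `N`
    -- vanishes.
    have : Injective (ModuleCat.of R N) :=
      injective_iff_subsingleton_ext_one.2 fun M => hN M (hflat h M)
    exact Module.injective_module_of_injective_object R N
  tfae_have 1 → 6 := by
    intro h I J hI hs _
    rw [h I hI hs, top_inf_eq, Ideal.top_mul]
  tfae_have 3 → 7 := by
    intro h I hI hs
    rw [Module.Flat.iff_characterModule_injective]
    have : Injective (ModuleCat.of R (CharacterModule (R ⧸ I))) :=
      injective_iff_subsingleton_ext_one.2 fun M => hcot I hI hs M (h M)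
    exact Module.injective_module_of_injective_object R _
  tfae_have 4 → 7 := by
    intro h I hI hs
    have : Projective (ModuleCat.of R (R ⧸ I)) :=
      projective_iff_subsingleton_ext_one.2 fun M => h M I hI hs
    have : Module.Projective R (R ⧸ I) := (IsProjective.iff_projective (R ⧸ I)).2 this
    infer_instance
  tfae_have 5 → 7 := fun h I hI hs =>
    Module.Flat.iff_characterModule_injective.2 (h _ (hcot I hI hs))
  tfae_have 6 → 7 := fun h I hI hs =>
    Ideal.Pure.of_inf_eq_mul I fun J hJ => h I J hI hs hJ
  tfae_have 7 → 8 := by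
    intro h I hI hs a ha
    have := h I hI hs
    obtain ⟨c, hc, hac⟩ := Ideal.exists_eq_mul_of_pure ha
    exact ⟨c, hc, by linear_combination hac⟩
  tfae_have 8 → 1 := by
    intro h I hI hs
    refine hs.eq_top_of_isIdempotentElem hI (le_antisymm Ideal.mul_le_left fun a ha => ?_)
    obtain ⟨c, hc, hac⟩ := h I hI hs a ha
    rw [show a = c * a by linear_combination hac]
    exact Ideal.mul_mem_mul hc ha
  tfae_finish
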